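/- Let $R$ be a commutative ring with $1$ in which $2$ is invertible, and let $n \ge 2$. Put $\psi_1 = \begin{pmatrix} 0 & 1\\ -1 & 0\end{pmatrix}$, let $\psi_n$ be the block diagonal matrix with $n$ diagonal blocks $\psi_1$, and let $\mathrm{Sp}_{2n}(R) = \{\alpha \in \mathrm{SL}_{2n}(R) : \alpha^t \psi_n \alpha = \psi_n\}$. Write $e_{ij}$ for the matrix with $1$ in position $(i,j)$ and $0$ elsewhere, and $\pi = (1\,2)(3\,4)\cdots(2n-1\,2n)$. Let $\mathrm{ESp}_{2n}(R)$ be the subgroup of $\mathrm{Sp}_{2n}(R)$ generated by the matrices $I_{2n} + x e_{12}$, $I_{2n} + x e_{21}$ and $$S_{ij}(x) = I_{2n} + x e_{ij} - (-1)^{i+j} x e_{\pi(j)\pi(i)}, \qquad 1 \le i, j \le 2n,\ i \ne j,\ j \neq \pi(i),\ x \in R.$$ For a row $X = (X_2, \dots, X_n)$ of $2\times 2$ matrices over $R$, let $$\mathrm{E}(X) = \begin{pmatrix} I_2 & X\\ \psi_{n-1} X^t \psi_1 & I_{2n-2}\end{pmatrix}.$$ Let $H(R)$ be the subgroup of $\mathrm{Sp}_{2n}(R)$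 generated by all matrices $\mathrm{E}(X)$, with $a_2,\dots,a_n \in R$ arbitrary, for which one of the following holds for all $k$ (the same one for all $k$): $$X_k = \begin{pmatrix} a_k & a_k\\ a_k & a_k\end{pmatrix},\quad X_k = \begin{pmatrix} a_k & -a_k\\ a_k & -a_k\end{pmatrix},\quad X_k = \begin{pmatrix} a_k & a_k\\ -a_k & -a_k\end{pmatrix},\quad X_k = \begin{pmatrix} -a_k & a_k\\ a_k & -a_k\end{pmatrix}$$ (these matrices do lie in $\mathrm{Sp}_{2n}(R)$). Then $H(R) = \mathrm{ESp}_{2n}(R)$, and this is a normal subgroup of $\mathrm{Sp}_{2n}(R)$. -/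

import Mathlib

open Matrix
open scoped Kronecker

/-- Row/column positions of a `2n × 2n` matrix, grouped into `n` consecutive pairs: with
`1`-based numbering, position `2k - 1` is `(k - 1, 0)` and position `2k` is `(k - 1, 1)`. -/
abbrev SpIdx (n : ℕ) : Type := Fin n × Fin 2

/-- The involution `π = (1 2)(3 4) ⋯ (2n-1 2n)`. -/
def SpIdx.swap {n : ℕ} (i : SpIdx n) : SpIdx n := (i.1, 1 - i.2)

section Forms

variable (n : ℕ) (R : Type*) [CommRing R]

/-- The standard `2 × 2` alternating matrix of Pfaffian one. -/
def psiOne : Matrix (Fin 2) (Fin 2) R := !![0, 1; -1, 0]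

/-- `ψ_n = ψ_1 ⊥ ⋯ ⊥ ψ_1` (`n` diagonal blocks). -/
def psi : Matrix (SpIdx n) (SpIdx n) R := (1 : Matrix (Fin n) (Fin n) R) ⊗ₖ psiOne R

/-- `Sp_{2n}(R) = {α ∈ SL_{2n}(R) | αᵗ ψ_n α = ψ_n}`. -/
def Sp : Subgroup (Matrix.SpecialLinearGroup (SpIdx n) R) where
  carrier := {α | (α : Matrix (SpIdx n) (SpIdx n) R)ᵀ * psi n R * α = psi n R}
  one_mem' := by simp
  mul_mem' := by
    intro a b ha hb
    simp only [Set.mem_ofPred_eq] at *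
    have h : ((a * b : Matrix.SpecialLinearGroup (SpIdx n) R) : Matrix (SpIdx n) (SpIdx n) R) =
        (a : Matrix (SpIdx n) (SpIdx n) R) * (b : Matrix (SpIdx n) (SpIdx n) R) :=
      Matrix.SpecialLinearGroup.coe_mul a b
    rw [h, transpose_mul]
    calc _ = (b : Matrix (SpIdx n) (SpIdx n) R)ᵀ *
          ((a : Matrix (SpIdx n) (SpIdx n) R)ᵀ * psi n R * a) * b := by
            simp only [Matrix.mul_assoc]
      _ = _ := by rw [ha, hb]
  inv_mem' := by
    intro a ha
    simp only [Set.mem_ofPred_eq] at *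
    have h : (a : Matrix (SpIdx n) (SpIdx n) R) * (a⁻¹ : Matrix.SpecialLinearGroup (SpIdx n) R) = 1 :=
      (Matrix.SpecialLinearGroup.coe_mul a a⁻¹).symm.trans (by rw [mul_inv_cancel]; rfl)
    have h' : ((a⁻¹ : Matrix.SpecialLinearGroup (SpIdx n) R) : Matrix (SpIdx n) (SpIdx n) R)ᵀ *
        (a : Matrix (SpIdx n) (SpIdx n) R)ᵀ = 1 := by
      rw [← transpose_mul, h, transpose_one]
    generalize ((a⁻¹ : Matrix.SpecialLinearGroup (SpIdx n) R) : Matrix (SpIdx n) (SpIdx n) R) = b at *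
    calc bᵀ * psi n R * b
        = bᵀ * ((a : Matrix (SpIdx n) (SpIdx n) R)ᵀ * psi n R * a) * b := by rw [ha]
      _ = (bᵀ * (a : Matrix (SpIdx n) (SpIdx n) R)ᵀ) * psi n R * (a * b) := by
            simp only [Matrix.mul_assoc]
      _ = psi n R := by rw [h, h', Matrix.one_mul, Matrix.mul_one]

end Forms

section Helpers

variable {n : ℕ} {R : Type*} [CommRing R]

theorem psi_apply (i j : SpIdx n) :
    psi n R i j = if i.1 = j.1 then psiOne R i.2 j.2 else 0 := by
  simp [psi, Matrix.one_apply]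

theorem psi_eq (i j : SpIdx n) :
    psi n R i j = if j = i.swap then (-1) ^ (i.2 : ℕ) else 0 := by
  obtain ⟨i, a⟩ := i
  obtain ⟨j, b⟩ := j
  rw [psi_apply]
  by_cases h : i = j
  · subst h
    fin_cases a <;> fin_cases b <;> simp [psiOne, SpIdx.swap]
  · have h' : ¬ j = i := fun e => h e.symm
    simp [SpIdx.swap, h, h']

theorem SpIdx.swap_swap (i : SpIdx n) : i.swap.swap = i := by
  simp [SpIdx.swap]

theorem SpIdx.swap_ne (i : SpIdx n) : i.swap ≠ i := by
  obtain ⟨i, a⟩ := i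
  fin_cases a <;> simp [SpIdx.swap]

theorem psi_transpose : (psi n R)ᵀ = -psi n R := by
  ext i j
  obtain ⟨i, a⟩ := i
  obtain ⟨j, b⟩ := j
  simp only [transpose_apply, Matrix.neg_apply, psi_apply]
  by_cases h : i = j
  · subst h
    fin_cases a <;> fin_cases b <;> simp [psiOne]
  · have h' : ¬ j = i := fun e => h e.symm
    simp [h, h']

theorem psi_mul_psi : psi n R * psi n R = -1 := by
  rw [psi, ← mul_kronecker_mul]
  have : psiOne R * psiOne R = -1 := by
    ext a b
    fin_cases a <;> fin_cases b <;> simp [psiOne]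
  rw [this]
  ext i j
  simp only [kroneckerMap_apply, Matrix.neg_apply, Matrix.one_apply, Prod.ext_iff]
  by_cases h : i.1 = j.1 <;> simp [h]

theorem det_eq_one_of_psi {A : Matrix (SpIdx n) (SpIdx n) R}
    (h : Aᵀ * psi n R * A = psi n R) : A.det = 1 := by
  let e : SpIdx n ≃ Fin n ⊕ Fin n :=
    { toFun := fun i => if i.2 = 0 then Sum.inl i.1 else Sum.inr i.1
      invFun := Sum.elim (fun k => (k, 0)) (fun k => (k, 1))
      left_inv := by rintro ⟨i, a⟩; fin_cases a <;> simp
      right_inv := by rintro (i | i) <;> simp }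
  have hJ : (psi n R).submatrix e.symm e.symm = -Matrix.J (Fin n) R := by
    ext i j
    rcases i with i | i <;> rcases j with j | j <;>
      simp [e, psi_apply, psiOne, Matrix.J, Matrix.one_apply]
    split_ifs <;> simp
  have h2 := congrArg (fun M => M.submatrix e.symm e.symm) h
  rw [← submatrix_mul_equiv _ _ _ e.symm, ← submatrix_mul_equiv _ _ _ e.symm, hJ] at h2
  have hm : A.submatrix e.symm e.symm ∈ Matrix.symplecticGroup (Fin n) R := by
    rw [SymplecticGroup.mem_iff']
    simpa [transpose_submatrix] using h2
  have := SymplecticGroup.det_eq_one hm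
  simpa [det_submatrix_equiv_self] using this

/-- A matrix preserving `ψ_n`, as an element of `Sp_{2n}(R)`. -/
def Sp.mk (A : Matrix (SpIdx n) (SpIdx n) R) (h : Aᵀ * psi n R * A = psi n R) : Sp n R :=
  ⟨⟨A, det_eq_one_of_psi h⟩, h⟩

theorem one_add_preserves {N : Matrix (SpIdx n) (SpIdx n) R}
    (h1 : Nᵀ * psi n R + psi n R * N = 0) (h2 : Nᵀ * (psi n R * N) = 0) :
    (1 + N)ᵀ * psi n R * (1 + N) = psi n R := by
  have : (1 + N)ᵀ * psi n R * (1 + N) =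
      psi n R + (Nᵀ * psi n R + psi n R * N) + Nᵀ * (psi n R * N) := by
    rw [transpose_add, transpose_one]
    noncomm_ring
  rw [this, h1, h2, add_zero, add_zero]

theorem psi_mul_single (i j : SpIdx n) (c : R) :
    psi n R * Matrix.single i j c = Matrix.single i.swap j (-(-1) ^ (i.2 : ℕ) * c) := by
  ext p q
  by_cases hq : j = q
  · subst hq
    rw [mul_single_apply_same, psi_eq]
    by_cases hp : i.swap = p
    · subst hp
      obtain ⟨i, a⟩ := i
      fin_cases a <;> simp [SpIdx.swap]
    · have : ¬ i = p.swap := fun e => hp (by rw [e, SpIdx.swap_swap])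
      simp [this, hp]
  · rw [mul_single_apply_of_ne _ _ _ _ _ (Ne.symm hq)]
    simp [hq]

theorem single_mul_psi (i j : SpIdx n) (c : R) :
    Matrix.single i j c * psi n R = Matrix.single i j.swap ((-1) ^ (j.2 : ℕ) * c) := by
  ext p q
  by_cases hp : i = p
  · subst hp
    rw [single_mul_apply_same, psi_eq]
    by_cases hq : q = j.swap
    · subst hq
      simp [mul_comm]
    · simp [hq, Ne.symm hq]
  · rw [single_mul_apply_of_ne _ _ _ _ _ (Ne.symm hp)]
    simp [hp]

end Helpers

section ElementarySymplectic

variable {n : ℕ} {R : Type*} [CommRing R]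

theorem transvection_preserves (i : SpIdx n) (x : R) :
    (transvection i i.swap x)ᵀ * psi n R * transvection i i.swap x = psi n R := by
  apply one_add_preserves
  · rw [transpose_single, psi_mul_single, single_mul_psi, ← Matrix.single_add]
    simp
  · rw [transpose_single, psi_mul_single, single_mul_single_of_ne]
    exact (SpIdx.swap_ne i).symm

/-- `E_{i π(i)}(x) = I_{2n} + x e_{i π(i)}`. -/
def elemLong (i : SpIdx n) (x : R) : Sp n R :=
  Sp.mk (transvection i i.swap x) (transvection_preserves i x)

/-- The matrix `S_{ij}(x) = I_{2n} + x e_{ij} - (-1)^{i+j} x e_{π(j) π(i)}`.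
The parity of a position is that of its second coordinate, up to a shift by one. -/
def shortMatrix (i j : SpIdx n) (x : R) : Matrix (SpIdx n) (SpIdx n) R :=
  1 + Matrix.single i j x
    - (-1 : R) ^ ((i.2 : ℕ) + (j.2 : ℕ)) • Matrix.single j.swap i.swap x

theorem shortMatrix_preserves (i j : SpIdx n) (hij : i ≠ j) (x : R) :
    (shortMatrix i j x)ᵀ * psi n R * shortMatrix i j x = psi n R := by
  have hs : i.swap ≠ j.swap := fun e => hij (by
    rw [← SpIdx.swap_swap i, e, SpIdx.swap_swap])
  rw [shortMatrix, add_sub_assoc]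
  apply one_add_preserves
  · rw [transpose_sub, transpose_smul, transpose_single, transpose_single, Matrix.sub_mul,
      Matrix.mul_sub, Matrix.smul_mul, Matrix.mul_smul, psi_mul_single, psi_mul_single,
      single_mul_psi, single_mul_psi, SpIdx.swap_swap, smul_single, smul_single]
    obtain ⟨i, a⟩ := i
    obtain ⟨j, b⟩ := j
    ext p q
    fin_cases a <;> fin_cases b <;>
      simp [SpIdx.swap, Matrix.single_apply]
  · rw [transpose_sub, transpose_smul, transpose_single, transpose_single,
      Matrix.mul_sub, Matrix.mul_smul, psi_mul_single, psi_mul_single, SpIdx.swap_swap,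
      Matrix.sub_mul, Matrix.mul_sub, Matrix.mul_sub]
    simp only [Matrix.smul_mul, Matrix.mul_smul]
    rw [single_mul_single_of_ne _ _ _ _ (SpIdx.swap_ne i).symm,
      single_mul_single_of_ne _ _ _ _ hij,
      single_mul_single_of_ne _ _ _ _ hs.symm,
      single_mul_single_of_ne _ _ _ _ (SpIdx.swap_ne j)]
    simp

/-- `S_{ij}(x)`, `i ≠ j`, as an element of `Sp_{2n}(R)`. -/
def elemShort (i j : SpIdx n) (hij : i ≠ j) (x : R) : Sp n R :=
  Sp.mk (shortMatrix i j x) (shortMatrix_preserves i j hij x)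

variable (n R) in
/-- `ESp_{2n}(R)`: the subgroup of `Sp_{2n}(R)` generated by `E_{12}(x)`, `E_{21}(x)` (positions
`1` and `2` are those in the first pair) and by the `S_{ij}(x)` with `i ≠ j ≠ π(i)`. -/
def ESp : Subgroup (Sp n R) :=
  Subgroup.closure
    ({g | ∃ (i : SpIdx n) (x : R), (i.1 : ℕ) = 0 ∧ g = elemLong i x} ∪
     {g | ∃ (i j : SpIdx n) (hij : i ≠ j) (x : R), j ≠ i.swap ∧ g = elemShort i j hij x})

end ElementarySymplectic

section SymmetricGenerators

variable {n : ℕ} {R : Type*} [CommRing R]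

/-- For `2 × 2` blocks `X_2, …, X_n` (numbered from `1`) the block matrix with identity diagonal
blocks, `(1, k)` block `X_k`, `(k, 1)` block `ψ_1 X_kᵗ ψ_1` for `k ≥ 2`, and zero blocks elsewhere,
that is, `(I_2, X; ψ_{n-1} Xᵗ ψ_1, I_{2n-2})` with `X = (X_2, …, X_n)`. In the code the first block
has number `0`, and the value of `X` there is not used. -/
def blockE (X : Fin n → Matrix (Fin 2) (Fin 2) R) : Matrix (SpIdx n) (SpIdx n) R :=
  1 + Matrix.of fun i j =>
    if (i.1 : ℕ) = 0 ∧ (j.1 : ℕ) ≠ 0 then X j.1 i.2 j.2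
    else if (i.1 : ℕ) ≠ 0 ∧ (j.1 : ℕ) = 0 then (psiOne R * (X i.1)ᵀ * psiOne R) i.2 j.2
    else 0

/-- The blocks `(l a_k, l b_k; m a_k, m b_k)`. -/
def rankOneBlocks (l m : R) (a b : Fin n → R) (k : Fin n) : Matrix (Fin 2) (Fin 2) R :=
  !![l * a k, l * b k; m * a k, m * b k]

theorem blockE_preserves (l m : R) (a b : Fin n → R) :
    (blockE (rankOneBlocks l m a b))ᵀ * psi n R * blockE (rankOneBlocks l m a b) = psi n R := by
  let V : Matrix (SpIdx n) (Fin 1) R :=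
    Matrix.of fun i _ => if (i.1 : ℕ) = 0 then ![l, m] i.2 else 0
  let W : Matrix (SpIdx n) (Fin 1) R :=
    Matrix.of fun i _ => if (i.1 : ℕ) = 0 then 0 else ![a i.1, b i.1] i.2
  have hpV : psi n R * V = Matrix.of fun i _ => if (i.1 : ℕ) = 0 then ![m, -l] i.2 else 0 := by
    ext i c
    simp only [Matrix.mul_apply, psi_eq, ite_mul, zero_mul, Finset.sum_ite_eq', Finset.mem_univ,
      if_true]
    obtain ⟨i, e⟩ := i
    fin_cases e <;> simp [V, SpIdx.swap]
  have hpW : psi n R * W =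
      Matrix.of fun i _ => if (i.1 : ℕ) = 0 then 0 else ![b i.1, -a i.1] i.2 := by
    ext i c
    simp only [Matrix.mul_apply, psi_eq, ite_mul, zero_mul, Finset.sum_ite_eq', Finset.mem_univ,
      if_true]
    obtain ⟨i, e⟩ := i
    fin_cases e <;> simp [W, SpIdx.swap]
  have hVp : Vᵀ * psi n R = -(psi n R * V)ᵀ := by
    rw [transpose_mul, psi_transpose]; simp
  have hE : blockE (rankOneBlocks l m a b) = 1 + (V * Wᵀ + (psi n R * W) * (Vᵀ * psi n R)) := by
    rw [hVp, hpV, hpW, blockE]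
    congr 1
    ext i j
    obtain ⟨i, e⟩ := i
    obtain ⟨j, f⟩ := j
    by_cases hi : (i : ℕ) = 0 <;> by_cases hj : (j : ℕ) = 0 <;> fin_cases e <;> fin_cases f <;>
      simp [V, W, hi, hj, Matrix.mul_apply, rankOneBlocks, psiOne, vecMul, dotProduct] <;>
      ring
  have hVW : Vᵀ * W = 0 := by
    ext c d
    simp only [Matrix.mul_apply, transpose_apply, Matrix.zero_apply]
    refine Finset.sum_eq_zero fun i _ => ?_
    by_cases hi : (i.1 : ℕ) = 0 <;> simp [V, W, hi]
  have hWV : Wᵀ * V = 0 := by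
    rw [← transpose_transpose (Wᵀ * V), transpose_mul, transpose_transpose, hVW, transpose_zero]
  have hVV : Vᵀ * (psi n R * V) = 0 := by
    rw [hpV]
    ext c d
    simp only [Matrix.mul_apply, transpose_apply, Matrix.zero_apply, Fintype.sum_prod_type]
    refine Finset.sum_eq_zero fun i _ => ?_
    by_cases hi : (i : ℕ) = 0 <;> simp [V, hi] <;> ring
  have hWW : Wᵀ * (psi n R * W) = 0 := by
    rw [hpW]
    ext c d
    simp only [Matrix.mul_apply, transpose_apply, Matrix.zero_apply, Fintype.sum_prod_type]
    refine Finset.sum_eq_zero fun i _ => ?_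
    by_cases hi : (i : ℕ) = 0 <;> simp [W, hi] <;> ring
  have hN : psi n R * (V * Wᵀ + (psi n R * W) * (Vᵀ * psi n R)) =
      psi n R * V * Wᵀ - W * (Vᵀ * psi n R) := by
    rw [Matrix.mul_add, ← Matrix.mul_assoc _ V, ← Matrix.mul_assoc _ (psi n R * W),
      ← Matrix.mul_assoc _ _ W, psi_mul_psi]
    simp [sub_eq_add_neg]
  have hNt : (V * Wᵀ + (psi n R * W) * (Vᵀ * psi n R))ᵀ =
      W * Vᵀ + psi n R * V * (Wᵀ * psi n R) := by
    simp only [transpose_add, transpose_mul, transpose_transpose, psi_transpose]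
    simp
  rw [hE]
  apply one_add_preserves
  · rw [hN, hNt, Matrix.add_mul, Matrix.mul_assoc (psi n R * V), Matrix.mul_assoc Wᵀ, psi_mul_psi,
      Matrix.mul_assoc W]
    simp only [Matrix.mul_neg, Matrix.mul_one]
    abel
  · rw [hN, hNt]
    have e1 : W * Vᵀ * (psi n R * V * Wᵀ) = 0 := by
      rw [Matrix.mul_assoc W, ← Matrix.mul_assoc Vᵀ, hVV]; simp
    have e2 : W * Vᵀ * (W * (Vᵀ * psi n R)) = 0 := by
      rw [Matrix.mul_assoc W, ← Matrix.mul_assoc Vᵀ, hVW]; simp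
    have e3 : psi n R * V * (Wᵀ * psi n R) * (psi n R * V * Wᵀ) = 0 := by
      have : Wᵀ * psi n R * (psi n R * V * Wᵀ) = Wᵀ * (psi n R * psi n R) * V * Wᵀ := by
        simp only [Matrix.mul_assoc]
      rw [Matrix.mul_assoc (psi n R * V), this, psi_mul_psi]
      simp [hWV]
    have e4 : psi n R * V * (Wᵀ * psi n R) * (W * (Vᵀ * psi n R)) = 0 := by
      have : Wᵀ * psi n R * (W * (Vᵀ * psi n R)) = Wᵀ * (psi n R * W) * (Vᵀ * psi n R) := by
        simp only [Matrix.mul_assoc]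
      rw [Matrix.mul_assoc (psi n R * V), this, hWW]
      simp
    rw [Matrix.add_mul, Matrix.mul_sub, Matrix.mul_sub, e1, e2, e3, e4]
    simp

/-- The symplectic matrix `E(l a, l b; m a, m b)`. -/
def spE (l m : R) (a b : Fin n → R) : Sp n R :=
  Sp.mk (blockE (rankOneBlocks l m a b)) (blockE_preserves l m a b)

/-- `E(A(a))`: all blocks of the form `(a, a; a, a)`. -/
def spEA (a : Fin n → R) : Sp n R := spE 1 1 a a

/-- `E(B(b))`: all blocks of the form `(b, -b; b, -b)`. -/
def spEB (b : Fin n → R) : Sp n R := spE 1 1 b (-b)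

/-- `E(C(c))`: all blocks of the form `(c, c; -c, -c)`. -/
def spEC (c : Fin n → R) : Sp n R := spE 1 (-1) c c

/-- `E(D(d))`: all blocks of the form `(-d, d; d, -d)`. -/
def spED (d : Fin n → R) : Sp n R := spE 1 (-1) (-d) d

variable (n R) in
/-- `H(R)`: the group generated by all `E(A)`, `E(B)`, `E(C)`, `E(D)`. -/
def spH : Subgroup (Sp n R) :=
  Subgroup.closure
    (Set.range spEA ∪ Set.range spEB ∪ Set.range spEC ∪ Set.range spED)

end SymmetricGenerators

/-!
For orthogonal column vectors `u`, `v` let `T(u, v)` be the symplectic transvection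
`w ↦ w + ⟨v, w⟩ u + ⟨u, w⟩ v`. Fix a subgroup `K` and say that `u` and `v` are related when `u ⊥ v`
and `T(u, c v) ∈ K` for all `c` (`TransvectionsIn`). Since `2` is invertible, this relation is
remarkably well behaved: it is symmetric, the vectors related to `u` form a submodule
(`TransvectionsIn.add_right`), it is preserved by `K` (`TransvectionsIn.map`), and if `v`, `v'` are
related to `u`, then the commutator of `T(u, v)` and `T(u, v')` shows that `⟨v, v'⟩ u` is related to
`u` (`TransvectionsIn.sympForm_smul_self`).

The generators of `ESp` are the transvections of pairs of orthogonal standard basis vectors, and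
those of `H` are transvections of pairs of vectors `e_1 ± e_2` and `∑ a_k (e_{2k-1} ± e_{2k})`. By
the rules above, each of the two groups contains the transvections of all pairs of orthogonal basis
vectors, the long ones `T(e_i, c e_i)` included (`containsElementary_ESp`,
`containsElementary_spH`), and any group that does contains both sets of generators. Hence
`H = ESp`.

For normality, the conjugate by `g ∈ Sp` of a generator is `T(g e_i, c g e_j)`, so it is enough that
a unimodular vector `v` is related to all of its orthogonal complement
(`ContainsElementary.transvectionsIn_of_unimodular`). That complement is spanned by the Koszul
vectors `⟨v, e_j⟩ e_i - ⟨v, e_i⟩ e_j`. Such a vector is a combination of two basis vectors, so it is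
related to every basis vector orthogonal to both, and what remains of `v` is a computation in rank at
most two (`TransvectionsIn.of_hyperbolic_pairs`).
-/

/-! ### Transvections attached to a subgroup -/

section Transvections

variable {n : ℕ} {R : Type*} [CommRing R]

/-- The alternating bilinear form `(u, v) ↦ uᵗ ψ_n v` on column vectors. -/
noncomputable def sympForm (n : ℕ) (R : Type*) [CommRing R] :
    LinearMap.BilinForm R (SpIdx n → R) :=
  Matrix.toBilin' (psi n R)

/-- The action of a symplectic matrix on column vectors. -/
def spAct (g : Sp n R) : (SpIdx n → R) →ₗ[R] (SpIdx n → R) :=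
  Matrix.mulVecLin (g.1 : Matrix (SpIdx n) (SpIdx n) R)

theorem sympForm_eq (u v : SpIdx n → R) : sympForm n R u v = u ⬝ᵥ (psi n R *ᵥ v) := by
  rw [sympForm, Matrix.toBilin'_apply']

theorem sympForm_neg_comm (u v : SpIdx n → R) : sympForm n R u v = -sympForm n R v u := by
  rw [sympForm_eq, sympForm_eq, dotProduct_comm v, dotProduct_mulVec, ← mulVec_transpose,
    psi_transpose, neg_mulVec, neg_dotProduct]

theorem psi_mulVec_apply (w : SpIdx n → R) (i : SpIdx n) :
    (psi n R *ᵥ w) i = (-1) ^ (i.2 : ℕ) * w i.swap := by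
  simp [mulVec, dotProduct, psi_eq]

theorem sympForm_self (u : SpIdx n → R) : sympForm n R u u = 0 := by
  rw [sympForm_eq, dotProduct, Fintype.sum_prod_type]
  refine Finset.sum_eq_zero fun k _ => ?_
  simp only [psi_mulVec_apply, Fin.sum_univ_two]
  simp [SpIdx.swap]
  ring

theorem sympForm_single (i : SpIdx n) (w : SpIdx n → R) :
    sympForm n R (Pi.single i 1) w = (-1) ^ (i.2 : ℕ) * w i.swap := by
  rw [sympForm_eq, single_one_dotProduct, psi_mulVec_apply]

theorem spAct_one (w : SpIdx n → R) : spAct 1 w = w := by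
  change (1 : Matrix (SpIdx n) (SpIdx n) R) *ᵥ w = w
  simp

theorem spAct_mul (g h : Sp n R) (w : SpIdx n → R) : spAct (g * h) w = spAct g (spAct h w) := by
  change ((g.1 : Matrix (SpIdx n) (SpIdx n) R) *
    (h.1 : Matrix (SpIdx n) (SpIdx n) R)) *ᵥ w = _
  simp [spAct]

theorem spAct_spAct_inv (g : Sp n R) (w : SpIdx n → R) : spAct g (spAct g⁻¹ w) = w := by
  rw [← spAct_mul, mul_inv_cancel, spAct_one]

theorem spAct_injective {g h : Sp n R} (H : ∀ w, spAct g w = spAct h w) : g = h := by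
  apply Subtype.ext
  apply Subtype.ext
  exact Matrix.mulVec_injective (funext H)

theorem sympForm_spAct (g : Sp n R) (u v : SpIdx n → R) :
    sympForm n R (spAct g u) (spAct g v) = sympForm n R u v := by
  have h : (g.1 : Matrix (SpIdx n) (SpIdx n) R)ᵀ * psi n R * g.1 = psi n R := g.2
  rw [sympForm_eq, sympForm_eq]
  conv_rhs => rw [← h]
  simp only [spAct, mulVecLin_apply, ← mulVec_mulVec]
  rw [dotProduct_mulVec u, vecMul_transpose]

/-- `g` acts as the symplectic transvection
`T(u, c v) : w ↦ w + c (⟨v, w⟩ u + ⟨u, w⟩ v)`. Orthogonality of `u` and `v` is not part of it. -/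
def ActsAsTransvection (g : Sp n R) (c : R) (u v : SpIdx n → R) : Prop :=
  ∀ w, spAct g w = w + c • (sympForm n R v w • u + sympForm n R u w • v)

theorem ActsAsTransvection.conj {k : Sp n R} {c : R} {u v : SpIdx n → R}
    (H : ActsAsTransvection k c u v) (g : Sp n R) :
    ActsAsTransvection (g * k * g⁻¹) c (spAct g u) (spAct g v) := by
  intro w
  obtain ⟨w, rfl⟩ : ∃ w', w = spAct g w' := ⟨_, (spAct_spAct_inv g w).symm⟩
  rw [spAct_mul, ← spAct_mul g⁻¹, inv_mul_cancel, spAct_one, spAct_mul, H]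
  simp only [sympForm_spAct, map_add, map_smul]

/-- `u` and `v` are orthogonal and `K` contains all the transvections `T(u, c v)`, `c ∈ R`. -/
def TransvectionsIn (K : Subgroup (Sp n R)) (u v : SpIdx n → R) : Prop :=
  sympForm n R u v = 0 ∧ ∀ c : R, ∃ g ∈ K, ActsAsTransvection g c u v

namespace TransvectionsIn

variable {K : Subgroup (Sp n R)} {u v v' : SpIdx n → R}

theorem symm (h : TransvectionsIn K u v) : TransvectionsIn K v u := by
  refine ⟨by rw [sympForm_neg_comm, h.1, neg_zero], fun c => ?_⟩
  obtain ⟨g, hg, H⟩ := h.2 c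
  exact ⟨g, hg, fun w => by rw [H, add_comm (_ • u)]⟩

theorem mem (h : TransvectionsIn K u v) {g : Sp n R} (c : R)
    (hg : ActsAsTransvection g c u v) : g ∈ K := by
  obtain ⟨g', hg', H⟩ := h.2 c
  rwa [spAct_injective fun w => (hg w).trans (H w).symm]

theorem zero_right : TransvectionsIn K u 0 :=
  ⟨by simp, fun c => ⟨1, K.one_mem, fun w => by simp [spAct_one]⟩⟩

theorem smul_right (a : R) (h : TransvectionsIn K u v) : TransvectionsIn K u (a • v) := by
  refine ⟨by simp [h.1], fun c => ?_⟩
  obtain ⟨g, hg, H⟩ := h.2 (c * a)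
  refine ⟨g, hg, fun w => ?_⟩
  rw [H]
  simp only [map_smul, LinearMap.smul_apply, smul_eq_mul]
  module

/-- Additivity in the second vector, from `T(u, v + v') = T(u, v/2) T(u, v') T(u, v/2)`: the
symmetric product makes the cross terms `⟨v, v'⟩` cancel. -/
theorem add_right (h2 : IsUnit (2 : R)) (h : TransvectionsIn K u v)
    (h' : TransvectionsIn K u v') : TransvectionsIn K u (v + v') := by
  refine ⟨by simp [h.1, h'.1], fun c => ?_⟩
  obtain ⟨t, ht⟩ := h2.exists_right_inv
  obtain ⟨g, hg, H⟩ := h.2 (c * t)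
  obtain ⟨g', hg', H'⟩ := h'.2 c
  refine ⟨g * g' * g, K.mul_mem (K.mul_mem hg hg') hg, fun w => ?_⟩
  have e1 := h.symm.1
  have e2 := h'.symm.1
  have e3 := sympForm_neg_comm v' v
  have e4 := sympForm_self u
  have e5 := sympForm_self v
  have hc : c * t + c * t = c := by linear_combination c * ht
  unfold ActsAsTransvection at H H'
  simp only [spAct_mul, H, H', map_add, map_smul, LinearMap.add_apply, smul_eq_mul, h.1, h'.1,
    e1, e2, e3, e4, e5]
  match_scalars
  · ring
  · linear_combination (sympForm n R v w) * hc
  · ring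
  · linear_combination (sympForm n R u w) * hc

/-- If `T(u, v)` and `T(u, v')` lie in `K`, then so do the transvections along
`⟨v, v'⟩ u`, since `T(u, v) T(u, v') = T(u, v + v') T(u, ⟨v, v'⟩ u / 2)`. -/
theorem sympForm_smul_self (h2 : IsUnit (2 : R)) (h : TransvectionsIn K u v)
    (h' : TransvectionsIn K u v') : TransvectionsIn K u (sympForm n R v v' • u) := by
  refine ⟨by simp [sympForm_self], fun c => ?_⟩
  obtain ⟨g, hg, H⟩ := h.2 (2 * c)
  obtain ⟨g', hg', H'⟩ := h'.2 1
  obtain ⟨k, hk, Hk⟩ := (((h.smul_right (2 * c)).add_right h2 h')).2 (-1)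
  refine ⟨g * g' * k, K.mul_mem (K.mul_mem hg hg') hk, fun w => ?_⟩
  have e1 := h.symm.1
  have e2 := h'.symm.1
  have e3 := sympForm_neg_comm v' v
  have e4 := sympForm_self u
  have e5 := sympForm_self v
  have e6 := sympForm_self v'
  unfold ActsAsTransvection at H H' Hk
  simp only [spAct_mul, H, H', Hk, map_add, map_smul, LinearMap.add_apply, LinearMap.smul_apply,
    smul_eq_mul, h.1, h'.1, e1, e2, e3, e4, e5, e6]
  module

/-- Polarization: `T(u, v) = T(u + v, (u + v) / 2) T(u, u / 2)⁻¹ T(v, v / 2)⁻¹`. -/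
theorem of_add_self (h2 : IsUnit (2 : R)) (huv : sympForm n R u v = 0)
    (hu : TransvectionsIn K u u) (hv : TransvectionsIn K v v)
    (h : TransvectionsIn K (u + v) (u + v)) : TransvectionsIn K u v := by
  refine ⟨huv, fun c => ?_⟩
  obtain ⟨t, ht⟩ := h2.exists_right_inv
  obtain ⟨g, hg, H⟩ := h.2 (c * t)
  obtain ⟨g', hg', H'⟩ := hu.2 (-(c * t))
  obtain ⟨k, hk, Hk⟩ := hv.2 (-(c * t))
  refine ⟨g * g' * k, K.mul_mem (K.mul_mem hg hg') hk, fun w => ?_⟩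
  have e1 : sympForm n R v u = 0 := by rw [sympForm_neg_comm, huv, neg_zero]
  have e4 := sympForm_self u
  have e5 := sympForm_self v
  unfold ActsAsTransvection at H H' Hk
  simp only [spAct_mul, H, H', Hk, map_add, map_smul, LinearMap.add_apply,
    smul_eq_mul, huv, e1, e4, e5]
  match_scalars
  · ring
  · linear_combination (c * sympForm n R v w) * ht
  · linear_combination (c * sympForm n R u w) * ht

theorem map {g : Sp n R} (hg : g ∈ K) (h : TransvectionsIn K u v) :
    TransvectionsIn K (spAct g u) (spAct g v) := by
  refine ⟨by rw [sympForm_spAct, h.1], fun c => ?_⟩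
  obtain ⟨k, hk, H⟩ := h.2 c
  exact ⟨g * k * g⁻¹, K.mul_mem (K.mul_mem hg hk) (K.inv_mem hg), H.conj g⟩

/-- The vectors `v` with `TransvectionsIn K u v` form a submodule. -/
def submodule (K : Subgroup (Sp n R)) (h2 : IsUnit (2 : R)) (u : SpIdx n → R) :
    Submodule R (SpIdx n → R) where
  carrier := {v | TransvectionsIn K u v}
  add_mem' := add_right h2
  zero_mem' := zero_right
  smul_mem' a _ := smul_right a

end TransvectionsIn

end Transvections

/-! ### Elementary transvections -/

section Elementary

variable {n : ℕ} {R : Type*} [CommRing R]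

/-- The standard basis vector at position `i`. -/
def stdVec (R : Type*) [CommRing R] {n : ℕ} (i : SpIdx n) : SpIdx n → R := Pi.single i 1

theorem sympForm_stdVec_left (i : SpIdx n) (w : SpIdx n → R) :
    sympForm n R (stdVec R i) w = (-1) ^ (i.2 : ℕ) * w i.swap :=
  sympForm_single i w

theorem sympForm_stdVec_right (v : SpIdx n → R) (i : SpIdx n) :
    sympForm n R v (stdVec R i) = -((-1) ^ (i.2 : ℕ) * v i.swap) := by
  rw [sympForm_neg_comm, sympForm_stdVec_left]

theorem sum_smul_stdVec (v : SpIdx n → R) : v = ∑ i, v i • stdVec R i := by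
  simp only [stdVec]
  exact pi_eq_sum_univ' v

theorem neg_one_pow_swap (i : SpIdx n) :
    (-1 : R) ^ (i.swap.2 : ℕ) = -(-1) ^ (i.2 : ℕ) := by
  obtain ⟨i, a⟩ := i
  fin_cases a <;> simp [SpIdx.swap]

theorem sympForm_stdVec_stdVec_swap (i : SpIdx n) :
    sympForm n R (stdVec R i) (stdVec R i.swap) = (-1) ^ (i.2 : ℕ) := by
  rw [sympForm_stdVec_left]; simp [stdVec]

theorem sympForm_stdVec_stdVec {i j : SpIdx n} (h : j ≠ i.swap) :
    sympForm n R (stdVec R i) (stdVec R j) = 0 := by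
  rw [sympForm_stdVec_left]; simp [stdVec, h.symm]

theorem neg_one_pow_mul_self (k : ℕ) : ((-1 : R) ^ k) * (-1) ^ k = 1 := by
  rw [← mul_pow]; simp

theorem actsAsTransvection_elemLong (i : SpIdx n) (x t : R) (ht : 2 * t = 1) :
    ActsAsTransvection (elemLong i x) ((-1) ^ (i.2 : ℕ) * x * t) (stdVec R i) (stdVec R i) := by
  intro w
  have h : spAct (elemLong i x) w = w + (x * w i.swap) • stdVec R i := by
    change (transvection i i.swap x) *ᵥ w = _
    rw [transvection, add_mulVec, one_mulVec, single_mulVec]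
    ext k
    by_cases hk : k = i <;> simp [stdVec, hk]
  rw [h, sympForm_stdVec_left]
  have := neg_one_pow_mul_self (R := R) (i.2 : ℕ)
  match_scalars
  · ring
  · linear_combination (-2 * x * t * w i.swap) * this - (x * w i.swap) * ht

theorem actsAsTransvection_elemShort (i j : SpIdx n) (hij : i ≠ j) (x : R) :
    ActsAsTransvection (elemShort i j hij x) (-(-1) ^ (j.2 : ℕ) * x)
      (stdVec R i) (stdVec R j.swap) := by
  intro w
  have h : spAct (elemShort i j hij x) w = w + (x * w j) • stdVec R i
      - ((-1) ^ ((i.2 : ℕ) + (j.2 : ℕ)) * (x * w i.swap)) • stdVec R j.swap := by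
    change (shortMatrix i j x) *ᵥ w = _
    rw [shortMatrix, sub_mulVec, add_mulVec, one_mulVec, single_mulVec, smul_mulVec,
      single_mulVec]
    ext k
    by_cases hk : k = i <;> by_cases hk' : k = j.swap <;> 
      simp [stdVec, hk, hk', Pi.single_apply, Function.update_apply]
  rw [h, sympForm_stdVec_left, sympForm_stdVec_left, neg_one_pow_swap, SpIdx.swap_swap]
  have := neg_one_pow_mul_self (R := R) (j.2 : ℕ)
  match_scalars
  · ring
  · linear_combination (-x * w j) * this
  · ring

/-- `K` contains all the transvections `T(e_i, c e_j)` for orthogonal standard basis vectors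
`e_i`, `e_j`, the case `i = j` included. -/
def ContainsElementary (K : Subgroup (Sp n R)) : Prop :=
  ∀ i j : SpIdx n, j ≠ i.swap → TransvectionsIn K (stdVec R i) (stdVec R j)

theorem ESp_le {K : Subgroup (Sp n R)} (h2 : IsUnit (2 : R)) (hK : ContainsElementary K) :
    ESp n R ≤ K := by
  obtain ⟨t, ht⟩ := h2.exists_right_inv
  rw [ESp, Subgroup.closure_le]
  rintro g (⟨i, x, -, rfl⟩ | ⟨i, j, hij, x, hj, rfl⟩)
  · exact (hK i i (SpIdx.swap_ne i).symm).mem _ (actsAsTransvection_elemLong i x t ht)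
  · refine (hK i j.swap fun h => hij ?_).mem _ (actsAsTransvection_elemShort i j hij x)
    rw [← SpIdx.swap_swap i, ← h, SpIdx.swap_swap]

namespace TransvectionsIn

variable {K : Subgroup (Sp n R)}

theorem add_left (h2 : IsUnit (2 : R)) {u u' v : SpIdx n → R} (h : TransvectionsIn K u v)
    (h' : TransvectionsIn K u' v) : TransvectionsIn K (u + u') v :=
  (h.symm.add_right h2 h'.symm).symm

theorem smul_left (a : R) {u v : SpIdx n → R} (h : TransvectionsIn K u v) :
    TransvectionsIn K (a • u) v :=
  (h.symm.smul_right a).symm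

theorem neg_left {u v : SpIdx n → R} (h : TransvectionsIn K u v) :
    TransvectionsIn K (-u) v := by
  simpa using h.smul_left (-1)

theorem neg_right {u v : SpIdx n → R} (h : TransvectionsIn K u v) :
    TransvectionsIn K u (-v) := by
  simpa using h.smul_right (-1)

theorem of_smul_right {a : R} (ha : IsUnit a) {u v : SpIdx n → R}
    (h : TransvectionsIn K u (a • v)) : TransvectionsIn K u v := by
  obtain ⟨b, hb⟩ := ha.exists_left_inv
  simpa [smul_smul, hb] using h.smul_right b

theorem sum_right (h2 : IsUnit (2 : R)) {ι : Type*} {s : Finset ι} {u : SpIdx n → R}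
    {f : ι → SpIdx n → R} (h : ∀ i ∈ s, TransvectionsIn K u (f i)) :
    TransvectionsIn K u (∑ i ∈ s, f i) :=
  (submodule K h2 u).sum_mem h

/-- It suffices to check the basis vectors in the support of `v`. -/
theorem of_support (h2 : IsUnit (2 : R)) {u v : SpIdx n → R}
    (h : ∀ k, v k ≠ 0 → TransvectionsIn K u (stdVec R k)) : TransvectionsIn K u v := by
  rw [sum_smul_stdVec v]
  refine sum_right h2 fun k _ => ?_
  by_cases hk : v k = 0
  · rw [hk, zero_smul]; exact zero_right
  · exact (h k hk).smul_right _

/-- A hyperbolic pair `e_k, e_{π(k)}` in the orthogonal complement of `u` gives the transvections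
along `u`. -/
theorem self_of_stdVec (h2 : IsUnit (2 : R)) {u : SpIdx n → R} {k : SpIdx n}
    (h : TransvectionsIn K u (stdVec R k)) (h' : TransvectionsIn K u (stdVec R k.swap)) :
    TransvectionsIn K u u := by
  have := h.sympForm_smul_self h2 h'
  rw [sympForm_stdVec_stdVec_swap] at this
  exact this.of_smul_right (isUnit_one.neg.pow _)

/-- For two mutually orthogonal hyperbolic pairs `a₁, b₁` and `a₂, b₂`, the transvection
`T(p a₁ + q a₂, q b₁ - p b₂)` acts on `⟨a₁, a₂⟩` through `I + (p, q)ᵗ (q, -p)`, up to sign. The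
sum `y` of the two vectors lies in the hyperbolic plane `⟨a₁ - b₂, b₁ + a₂⟩`, whose complement
contains the hyperbolic pair `a₁ + b₂, b₁ - a₂`; so the commutator rule gives the transvections
along `y`, and polarization concludes. -/
theorem of_hyperbolic_pairs (h2 : IsUnit (2 : R)) {a₁ b₁ a₂ b₂ : SpIdx n → R}
    (h₁ : sympForm n R a₁ b₁ = 1) (h₂ : sympForm n R a₂ b₂ = 1)
    (ha₁ : TransvectionsIn K a₁ a₁) (hb₁ : TransvectionsIn K b₁ b₁)
    (ha₂ : TransvectionsIn K a₂ a₂) (hb₂ : TransvectionsIn K b₂ b₂)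
    (haa : TransvectionsIn K a₁ a₂) (hbb : TransvectionsIn K b₁ b₂)
    (hab : TransvectionsIn K a₁ b₂) (hba : TransvectionsIn K b₁ a₂) (p q : R) :
    TransvectionsIn K (p • a₁ + q • a₂) (q • b₁ - p • b₂) := by
  have hu : TransvectionsIn K (p • a₁ + q • a₂) (p • a₁ + q • a₂) :=
    (((ha₁.smul_left p).add_left h2 (haa.symm.smul_left q)).smul_right p).add_right h2
      (((haa.smul_left p).add_left h2 (ha₂.smul_left q)).smul_right q)
  have hx : TransvectionsIn K (q • b₁ - p • b₂) (q • b₁ - p • b₂) := by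
    rw [sub_eq_add_neg]
    exact (((hb₁.smul_left q).add_left h2 (hbb.symm.smul_left p).neg_left).smul_right q).add_right
      h2 (((hbb.smul_left q).add_left h2 (hb₂.smul_left p).neg_left).smul_right p).neg_right
  have e₁ : sympForm n R b₁ a₁ = -1 := by rw [sympForm_neg_comm, h₁]
  have e₂ : sympForm n R b₂ a₂ = -1 := by rw [sympForm_neg_comm, h₂]
  have cross (c : R) : TransvectionsIn K (a₁ + c • b₂) (a₂ + c • b₁) := by
    obtain ⟨g, hg, H⟩ := hbb.2 (-c)
    have := haa.map hg
    rw [H, H] at this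
    simpa [e₁, e₂, hab.symm.1, hba.1] using this
  have h₁₃ : TransvectionsIn K (a₁ - b₂) (a₁ + b₂) := by
    rw [sub_eq_add_neg]
    exact (ha₁.add_right h2 hab).add_left h2 (hab.symm.add_right h2 hb₂).neg_left
  have h₂₃ : TransvectionsIn K (b₁ + a₂) (a₁ + b₂) := by
    simpa [add_comm] using (cross 1).symm
  have h₁₄ : TransvectionsIn K (a₁ - b₂) (b₁ - a₂) := by
    have := (cross (-1)).neg_right
    simpa [sub_eq_add_neg, add_comm] using this
  have h₂₄ : TransvectionsIn K (b₁ + a₂) (b₁ - a₂) := by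
    rw [sub_eq_add_neg b₁]
    exact (hb₁.add_right h2 hba.neg_right).add_left h2
      (hba.symm.add_right h2 ha₂.neg_right)
  have hy : p • a₁ + q • a₂ + (q • b₁ - p • b₂) = p • (a₁ - b₂) + q • (b₁ + a₂) := by module
  have h₃₄ : sympForm n R (a₁ + b₂) (b₁ - a₂) = 2 := by
    simp only [map_add, map_sub, LinearMap.add_apply, h₁, haa.1, hbb.symm.1, e₂]
    ring
  have self := ((h₁₃.smul_left p).add_left h2 (h₂₃.smul_left q)).sympForm_smul_self h2
    ((h₁₄.smul_left p).add_left h2 (h₂₄.smul_left q))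
  rw [h₃₄] at self
  refine of_add_self h2 ?_ hu hx (by rw [hy]; exact self.of_smul_right h2)
  simp only [map_add, map_sub, map_smul, LinearMap.add_apply, LinearMap.smul_apply, smul_eq_mul,
    h₁, h₂, hab.1, hba.symm.1]
  ring

end TransvectionsIn

end Elementary

/-! ### Normality of the elementary group -/

section Normality

variable {n : ℕ} {R : Type*} [CommRing R]

namespace ContainsElementary

variable {K : Subgroup (Sp n R)}

/-- The Koszul vector `⟨v, e_j⟩ e_i - ⟨v, e_i⟩ e_j` for `j ≠ i, π(i)`. -/
theorem koszul_of_ne (h2 : IsUnit (2 : R)) (hK : ContainsElementary K) (v : SpIdx n → R)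
    {i j : SpIdx n} (hij : j ≠ i) (hij' : j ≠ i.swap) :
    TransvectionsIn K (sympForm n R v (stdVec R j) • stdVec R i -
      sympForm n R v (stdVec R i) • stdVec R j) v := by
  have hji' : i ≠ j.swap := fun h => hij' (by rw [h, SpIdx.swap_swap])
  have hss : i.swap ≠ j.swap := fun h => hij (by rw [← SpIdx.swap_swap i, h, SpIdx.swap_swap])
  set p : R := -((-1) ^ (j.2 : ℕ) * v j.swap) with hp
  set q : R := (-1) ^ (i.2 : ℕ) * v i.swap with hq
  have hu : sympForm n R v (stdVec R j) • stdVec R i - sympForm n R v (stdVec R i) • stdVec R j =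
      p • stdVec R i + q • stdVec R j := by
    rw [sympForm_stdVec_right, sympForm_stdVec_right]
    module
  rw [hu]
  set x : SpIdx n → R := v i.swap • stdVec R i.swap + v j.swap • stdVec R j.swap with hx
  -- the part `x` of `v` not orthogonal to `e_i` and `e_j` needs the rank two computation
  have hux : TransvectionsIn K (p • stdVec R i + q • stdVec R j) x := by
    have hi := neg_one_pow_mul_self (R := R) (i.2 : ℕ)
    have hj := neg_one_pow_mul_self (R := R) (j.2 : ℕ)
    have hx' : x = q • (-1 : R) ^ (i.2 : ℕ) • stdVec R i.swap -
        p • (-1 : R) ^ (j.2 : ℕ) • stdVec R j.swap := by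
      rw [hx, hp, hq]
      match_scalars
      · linear_combination (-v i.swap) * hi
      · linear_combination (-v j.swap) * hj
    have hself (k : SpIdx n) := hK k k (SpIdx.swap_ne k).symm
    rw [hx']
    refine TransvectionsIn.of_hyperbolic_pairs h2 ?_ ?_ (hself i)
      (((hself _).smul_left _).smul_right _) (hself j) (((hself _).smul_left _).smul_right _)
      (hK _ _ hij') (((hK _ _ ?_).smul_left _).smul_right _)
      ((hK _ _ hss.symm).smul_right _) ((hK _ _ ?_).smul_left _) p q
    · rw [map_smul, sympForm_stdVec_stdVec_swap, smul_eq_mul, hi]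
    · rw [map_smul, sympForm_stdVec_stdVec_swap, smul_eq_mul, hj]
    · rw [SpIdx.swap_swap]; exact hji'.symm
    · rw [SpIdx.swap_swap]; exact hij
  have hrest : TransvectionsIn K (p • stdVec R i + q • stdVec R j) (v - x) := by
    refine TransvectionsIn.of_support h2 fun k hk => ?_
    have hki : k ≠ i.swap := by
      rintro rfl
      simp [hx, stdVec, hss] at hk
    have hkj : k ≠ j.swap := by
      rintro rfl
      simp [hx, stdVec, hss.symm] at hk
    exact ((hK i k hki).smul_left p).add_left h2 ((hK j k hkj).smul_left q)
  simpa using hrest.add_right h2 hux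

/-- The Koszul vector `⟨v, e_j⟩ e_i - ⟨v, e_i⟩ e_j` for `j = π(i)`: up to sign it is the component
of `v` in the `i`-th hyperbolic plane, and a second hyperbolic plane is at hand since `n ≥ 2`. -/
theorem koszul_swap (h2 : IsUnit (2 : R)) (hn : 2 ≤ n) (hK : ContainsElementary K)
    (v : SpIdx n → R) (i : SpIdx n) :
    TransvectionsIn K (sympForm n R v (stdVec R i.swap) • stdVec R i -
      sympForm n R v (stdVec R i) • stdVec R i.swap) v := by
  set x : SpIdx n → R := v i • stdVec R i + v i.swap • stdVec R i.swap with hx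
  have hu : sympForm n R v (stdVec R i.swap) • stdVec R i -
      sympForm n R v (stdVec R i) • stdVec R i.swap = (-1 : R) ^ (i.2 : ℕ) • x := by
    rw [sympForm_stdVec_right, sympForm_stdVec_right, SpIdx.swap_swap, neg_one_pow_swap, hx]
    module
  rw [hu]
  refine TransvectionsIn.smul_left _ ?_
  have hxk {k : SpIdx n} (hki : k ≠ i) (hki' : k ≠ i.swap) :
      TransvectionsIn K x (stdVec R k) :=
    ((hK i k hki').smul_left _).add_left h2
      ((hK i.swap k (by rwa [SpIdx.swap_swap])).smul_left _)
  have hself : TransvectionsIn K x x := by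
    have : Nontrivial (Fin n) := Fin.nontrivial_iff_two_le.mpr hn
    obtain ⟨k, hk⟩ := exists_ne i.1
    refine TransvectionsIn.self_of_stdVec h2 (k := (k, 0)) (hxk ?_ ?_) (hxk ?_ ?_) <;>
      exact fun h => hk (congrArg Prod.fst h)
  have hrest : TransvectionsIn K x (v - x) := by
    refine TransvectionsIn.of_support h2 fun k hk => hxk ?_ ?_
    · rintro rfl
      simp [hx, stdVec, (SpIdx.swap_ne _).symm] at hk
    · rintro rfl
      simp [hx, stdVec, SpIdx.swap_ne] at hk
  simpa using hrest.add_right h2 hself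

/-- If `v` is unimodular, then the vectors orthogonal to `v` are combinations of Koszul vectors,
so `K` contains `T(v, u)` for all `u ⊥ v`. -/
theorem transvectionsIn_of_unimodular (h2 : IsUnit (2 : R)) (hn : 2 ≤ n)
    (hK : ContainsElementary K) {u v w : SpIdx n → R} (hvw : sympForm n R v w = 1)
    (hvu : sympForm n R v u = 0) : TransvectionsIn K v u := by
  have expand (z : SpIdx n → R) : sympForm n R v z = ∑ i, z i * sympForm n R v (stdVec R i) := by
    conv_lhs => rw [sum_smul_stdVec z]
    simp
  have hdecomp : u = ∑ i, ∑ j, (u i * w j) • (sympForm n R v (stdVec R j) • stdVec R i -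
      sympForm n R v (stdVec R i) • stdVec R j) := by
    have h1 : ∑ i, ∑ j, (u i * w j) • sympForm n R v (stdVec R j) • stdVec R i = u := by
      conv_rhs => rw [sum_smul_stdVec u]
      refine Finset.sum_congr rfl fun i _ => ?_
      rw [← one_smul R (u i • stdVec R i), ← hvw, expand w, Finset.sum_smul]
      refine Finset.sum_congr rfl fun j _ => ?_
      module
    have h0 : ∑ i, ∑ j, (u i * w j) • sympForm n R v (stdVec R i) • stdVec R j = 0 := by
      rw [Finset.sum_comm]
      refine Finset.sum_eq_zero fun j _ => ?_
      rw [← zero_smul R (w j • stdVec R j), ← hvu, expand u, Finset.sum_smul]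
      refine Finset.sum_congr rfl fun i _ => ?_
      module
    simp only [smul_sub, Finset.sum_sub_distrib, h1, h0, sub_zero]
  rw [hdecomp]
  refine TransvectionsIn.sum_right h2 fun i _ => TransvectionsIn.sum_right h2 fun j _ =>
    TransvectionsIn.smul_right _ (TransvectionsIn.symm ?_)
  by_cases hij : j = i
  · subst hij
    rw [sub_self]
    exact TransvectionsIn.zero_right.symm
  by_cases hij' : j = i.swap
  · subst hij'
    exact koszul_swap h2 hn hK v i
  · exact koszul_of_ne h2 hK v hij hij'

end ContainsElementary

/-- The conjugate by `g` of a generator `T(e_i, c e_j)` is `T(g e_i, c g e_j)`, and `g e_i` is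
unimodular. -/
theorem ESp_normal (h2 : IsUnit (2 : R)) (hn : 2 ≤ n)
    (hK : ContainsElementary (ESp n R)) : (ESp n R).Normal := by
  obtain ⟨t, ht⟩ := h2.exists_right_inv
  have key (g k : Sp n R) (c : R) (i j : SpIdx n) (hij : j ≠ i.swap)
      (hk : ActsAsTransvection k c (stdVec R i) (stdVec R j)) : g * k * g⁻¹ ∈ ESp n R := by
    refine TransvectionsIn.mem (u := spAct g (stdVec R i)) (v := spAct g (stdVec R j)) ?_ c
      (hk.conj g)
    refine hK.transvectionsIn_of_unimodular h2 hn
      (w := spAct g ((-1 : R) ^ (i.2 : ℕ) • stdVec R i.swap)) ?_ ?_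
    · rw [sympForm_spAct, map_smul, sympForm_stdVec_stdVec_swap, smul_eq_mul,
        neg_one_pow_mul_self]
    · rw [sympForm_spAct, sympForm_stdVec_stdVec hij]
  refine ⟨fun k hk g => ?_⟩
  suffices h : ESp n R ≤ (ESp n R).comap (MulAut.conj g).toMonoidHom from h hk
  conv_lhs => rw [ESp]
  rw [Subgroup.closure_le]
  rintro k (⟨i, x, -, rfl⟩ | ⟨i, j, hij, x, hj, rfl⟩)
  · exact key g _ _ i i (SpIdx.swap_ne i).symm (actsAsTransvection_elemLong i x t ht)
  · refine key g _ _ i j.swap (fun h => hij ?_) (actsAsTransvection_elemShort i j hij x)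
    rw [← SpIdx.swap_swap i, ← h, SpIdx.swap_swap]

theorem containsElementary_ESp (h2 : IsUnit (2 : R)) (hn : 2 ≤ n) :
    ContainsElementary (ESp n R) := by
  have hne {i j : SpIdx n} (hij : i ≠ j) (hj : j ≠ i.swap) :
      TransvectionsIn (ESp n R) (stdVec R i) (stdVec R j) := by
    refine ⟨sympForm_stdVec_stdVec hj, fun c => ?_⟩
    have hij' : i ≠ j.swap := fun h => hj (by rw [h, SpIdx.swap_swap])
    have hss : j.swap ≠ i.swap := fun h =>
      hij (by rw [← SpIdx.swap_swap i, ← h, SpIdx.swap_swap])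
    refine ⟨elemShort i j.swap hij' ((-1) ^ (j.2 : ℕ) * c),
      Subgroup.subset_closure (Or.inr ⟨i, j.swap, hij', _, hss, rfl⟩), ?_⟩
    have := actsAsTransvection_elemShort i j.swap hij' ((-1) ^ (j.2 : ℕ) * c)
    rwa [SpIdx.swap_swap, neg_one_pow_swap, neg_neg, ← mul_assoc, neg_one_pow_mul_self,
      one_mul] at this
  intro i j hj
  by_cases hij : i = j
  · subst hij
    have : Nontrivial (Fin n) := Fin.nontrivial_iff_two_le.mpr hn
    obtain ⟨k, hk⟩ := exists_ne i.1
    refine TransvectionsIn.self_of_stdVec h2 (k := (k, 0)) (hne ?_ ?_) (hne ?_ ?_) <;>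
      intro h <;> first
        | exact hk (congrArg Prod.fst h)
        | exact hk (congrArg Prod.fst h).symm
  · exact hne hij hj

end Normality

/-! ### The generators of `H(R)` as transvections -/

section SymmetricTransvections

variable {n : ℕ} {R : Type*} [CommRing R]

/-- The column vector `(l, m, 0, …, 0)`. -/
def firstPlaneVec (n : ℕ) (l m : R) (i : SpIdx n) : R :=
  if (i.1 : ℕ) = 0 then ![l, m] i.2 else 0

/-- The column vector with entries `0, 0` in the first plane and `b_k, -a_k` in each other plane,
so that its form with `w` is `∑ (a_k w_{2k-1} + b_k w_{2k})`, the sum over `k ≥ 2`. -/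
def otherPlanesVec (a b : Fin n → R) (i : SpIdx n) : R :=
  if (i.1 : ℕ) = 0 then 0 else ![b i.1, -a i.1] i.2

/-- `E(X)` for `X_k = (l, m)ᵗ (a_k, b_k)` is the transvection `T(u, z)` for the vector `u` equal to
`(l, m)` in the first plane and `z` equal to `(b_k, -a_k)` in the others. -/
theorem actsAsTransvection_spE (l m : R) (a b : Fin n → R) :
    ActsAsTransvection (spE l m a b) 1 (firstPlaneVec n l m) (otherPlanesVec a b) := by
  intro w
  change blockE (rankOneBlocks l m a b) *ᵥ w = _
  rw [blockE, add_mulVec, one_mulVec, one_smul]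
  congr 1
  rcases n with _ | n
  · ext ⟨i, -⟩
    exact i.elim0
  have hV : sympForm (n + 1) R (firstPlaneVec (n + 1) l m) w = l * w (0, 1) - m * w (0, 0) := by
    simp [sympForm_eq, dotProduct, psi_mulVec_apply, Fintype.sum_prod_type, Fin.sum_univ_succ,
      firstPlaneVec, SpIdx.swap]
    ring
  have hW : sympForm (n + 1) R (otherPlanesVec a b) w =
      ∑ k : Fin n, (a k.succ * w (k.succ, 0) + b k.succ * w (k.succ, 1)) := by
    simp only [sympForm_eq, dotProduct, psi_mulVec_apply, Fintype.sum_prod_type,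
      Fin.sum_univ_succ (n := n), otherPlanesVec, SpIdx.swap, Fin.sum_univ_two]
    simp
    refine Finset.sum_congr rfl fun k _ => ?_
    ring
  rw [hV, hW]
  ext ⟨i, e⟩
  simp only [mulVec, dotProduct, of_apply, Fintype.sum_prod_type, Fin.sum_univ_succ (n := n),
    Fin.sum_univ_two]
  refine Fin.cases ?_ (fun i => ?_) i
  · fin_cases e <;> simp [rankOneBlocks, firstPlaneVec, otherPlanesVec, Finset.sum_mul] <;>
      refine Finset.sum_congr rfl fun k _ => ?_ <;> ring
  · fin_cases e <;>
      simp [rankOneBlocks, firstPlaneVec, otherPlanesVec, psiOne, Matrix.mul_apply, vecMul,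
        dotProduct] <;>
      ring

/-- `K` contains the transvections `T((l, m, 0, …), c z)` as soon as it contains the matrices
`E(X)` attached to all multiples of `(a, b)`. -/
theorem transvectionsIn_of_spE_mem {K : Subgroup (Sp n R)} {l m : R} {a b : Fin n → R}
    (h : ∀ c : R, spE l m (c • a) (c • b) ∈ K) :
    TransvectionsIn K (firstPlaneVec n l m) (otherPlanesVec a b) := by
  refine ⟨?_, fun c => ⟨_, h c, fun w => ?_⟩⟩
  · rw [sympForm_eq, dotProduct]
    refine Finset.sum_eq_zero fun i _ => ?_
    rw [psi_mulVec_apply]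
    by_cases hi : (i.1 : ℕ) = 0 <;> simp [firstPlaneVec, otherPlanesVec, SpIdx.swap, hi]
  · have hc : otherPlanesVec (c • a) (c • b) = c • otherPlanesVec a b := by
      ext ⟨i, e⟩
      by_cases hi : (i : ℕ) = 0 <;> fin_cases e <;> simp [otherPlanesVec, hi]
    rw [actsAsTransvection_spE, hc]
    simp only [map_smul, LinearMap.smul_apply, smul_eq_mul]
    module

theorem spE_mem {K : Subgroup (Sp n R)} (h2 : IsUnit (2 : R)) (hK : ContainsElementary K)
    (l m : R) (a b : Fin n → R) : spE l m a b ∈ K := by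
  refine TransvectionsIn.mem ?_ 1 (actsAsTransvection_spE l m a b)
  refine TransvectionsIn.of_support h2 fun j hj => TransvectionsIn.symm
    (TransvectionsIn.of_support h2 fun i hi => hK j i ?_)
  rintro rfl
  by_cases h0 : (j.1 : ℕ) = 0
  · simp [otherPlanesVec, h0] at hj
  · simp [firstPlaneVec, SpIdx.swap, h0] at hi

theorem spH_le {K : Subgroup (Sp n R)} (h2 : IsUnit (2 : R)) (hK : ContainsElementary K) :
    spH n R ≤ K := by
  rw [spH, Subgroup.closure_le]
  rintro g (((⟨a, rfl⟩ | ⟨a, rfl⟩) | ⟨a, rfl⟩) | ⟨a, rfl⟩) <;> exact spE_mem h2 hK _ _ _ _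

/-- The generators of `H(R)` are the transvections between the vectors `e_1 ± e_2` of the first plane
and combinations of the vectors `e_{2k-1} ± e_{2k}` of the others. As `2` is invertible these give
the pairs of a basis vector in the first plane and one outside; commutators give the rest. -/
theorem containsElementary_spH (h2 : IsUnit (2 : R)) (hn : 2 ≤ n) :
    ContainsElementary (spH n R) := by
  obtain ⟨n, rfl⟩ : ∃ m, n = m + 2 := ⟨n - 2, by omega⟩
  have hA (a : Fin (n + 2) → R) :
      TransvectionsIn (spH (n + 2) R) (firstPlaneVec _ 1 1) (otherPlanesVec a a) :=
    transvectionsIn_of_spE_mem fun c => Subgroup.subset_closure (Or.inl (Or.inl (Or.inl ⟨_, rfl⟩)))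
  have hB (a : Fin (n + 2) → R) :
      TransvectionsIn (spH (n + 2) R) (firstPlaneVec _ 1 1) (otherPlanesVec a (-a)) :=
    transvectionsIn_of_spE_mem fun c =>
      Subgroup.subset_closure (Or.inl (Or.inl (Or.inr ⟨c • a, by rw [spEB, smul_neg]⟩)))
  have hC (a : Fin (n + 2) → R) :
      TransvectionsIn (spH (n + 2) R) (firstPlaneVec _ 1 (-1)) (otherPlanesVec a a) :=
    transvectionsIn_of_spE_mem fun c => Subgroup.subset_closure (Or.inl (Or.inr ⟨_, rfl⟩))
  have hD (a : Fin (n + 2) → R) :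
      TransvectionsIn (spH (n + 2) R) (firstPlaneVec _ 1 (-1)) (otherPlanesVec (-a) a) :=
    transvectionsIn_of_spE_mem fun c =>
      Subgroup.subset_closure (Or.inr ⟨c • a, by rw [spED, smul_neg]⟩)
  -- the two patterns of coordinates `(a, a)` and `(a, -a)` span each plane, as `2` is invertible
  have hright {l m : R} (hs : ∀ a : Fin (n + 2) → R,
      TransvectionsIn (spH (n + 2) R) (firstPlaneVec _ l m) (otherPlanesVec a a) ∧
      TransvectionsIn (spH (n + 2) R) (firstPlaneVec _ l m) (otherPlanesVec (-a) a))
      {j : SpIdx (n + 2)} (hj : j.1 ≠ 0) :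
      TransvectionsIn (spH (n + 2) R) (firstPlaneVec _ l m) (stdVec R j) := by
    obtain ⟨k, f⟩ := j
    have hk : ¬ (k : ℕ) = 0 := fun h => hj (Fin.ext h)
    obtain ⟨h, h'⟩ := hs (Pi.single k 1)
    have hsum : (2 : R) • stdVec R (k, 0) =
        otherPlanesVec (Pi.single k (1 : R)) (Pi.single k 1) +
        otherPlanesVec (-Pi.single k (1 : R)) (Pi.single k 1) := by
      ext ⟨i, e⟩
      by_cases hi : i = k
      · subst hi
        fin_cases e <;> simp [otherPlanesVec, stdVec, hk]
        norm_num
      · fin_cases e <;> simp [otherPlanesVec, stdVec, hi]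
    have hdiff : (2 : R) • stdVec R (k, 1) =
        otherPlanesVec (-Pi.single k (1 : R)) (Pi.single k 1) +
        -otherPlanesVec (Pi.single k (1 : R)) (Pi.single k 1) := by
      ext ⟨i, e⟩
      by_cases hi : i = k
      · subst hi
        fin_cases e <;> simp [otherPlanesVec, stdVec, hk]
        norm_num
      · fin_cases e <;> simp [otherPlanesVec, stdVec, hi]
    fin_cases f
    · exact (hsum ▸ h.add_right h2 h').of_smul_right h2
    · exact (hdiff ▸ h'.add_right h2 h.neg_right).of_smul_right h2
  have hneg (a : Fin (n + 2) → R) : otherPlanesVec (-a) a = -otherPlanesVec a (-a) := by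
    ext ⟨i, e⟩
    by_cases hi : (i : ℕ) = 0 <;> fin_cases e <;> simp [otherPlanesVec, hi]
  have hfirst {i j : SpIdx (n + 2)} (hi : i.1 = 0) (hj : j.1 ≠ 0) :
      TransvectionsIn (spH (n + 2) R) (stdVec R i) (stdVec R j) := by
    have hp := (hright (fun a => ⟨hA a, by rw [hneg]; exact (hB a).neg_right⟩) hj).symm
    have hm := (hright (fun a => ⟨hC a, hD a⟩) hj).symm
    obtain ⟨k, e⟩ := i
    obtain rfl : k = 0 := hi
    have hsum : (2 : R) • stdVec R ((0, 0) : SpIdx (n + 2)) =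
        firstPlaneVec _ 1 1 + firstPlaneVec _ 1 (-1) := by
      ext ⟨i, e⟩
      refine Fin.cases ?_ (fun i => ?_) i <;> fin_cases e <;>
        simp [firstPlaneVec, stdVec]
      norm_num
    have hdiff : (2 : R) • stdVec R ((0, 1) : SpIdx (n + 2)) =
        firstPlaneVec _ 1 1 + -firstPlaneVec _ 1 (-1) := by
      ext ⟨i, e⟩
      refine Fin.cases ?_ (fun i => ?_) i <;> fin_cases e <;>
        simp [firstPlaneVec, stdVec]
      norm_num
    refine TransvectionsIn.symm ?_
    fin_cases e
    · exact (hsum ▸ hp.add_right h2 hm).of_smul_right h2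
    · exact (hdiff ▸ hp.add_right h2 hm.neg_right).of_smul_right h2
  have hself (i : SpIdx (n + 2)) : TransvectionsIn (spH (n + 2) R) (stdVec R i) (stdVec R i) := by
    by_cases hi : i.1 = 0
    · exact TransvectionsIn.self_of_stdVec h2 (k := (1, 0)) (hfirst hi (by simp))
        (hfirst hi (by simp [SpIdx.swap]))
    · exact TransvectionsIn.self_of_stdVec h2 (k := (0, 0)) (hfirst rfl hi).symm
        (hfirst rfl hi).symm
  intro i j hij
  by_cases hi : i.1 = 0 <;> by_cases hj : j.1 = 0
  · obtain ⟨k, e⟩ := i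
    obtain ⟨k', f⟩ := j
    obtain rfl : k = 0 := hi
    obtain rfl : k' = 0 := hj
    have : f = e := by
      fin_cases e <;> fin_cases f <;> simp [SpIdx.swap] at hij ⊢
    exact this ▸ hself _
  · exact hfirst hi hj
  · exact (hfirst hj hi).symm
  by_cases hji : j = i
  · exact hji ▸ hself i
  -- moving the pair `e_i, e_0` by `T(e_{π(0)}, e_j)` sends `e_0` to `e_0 ± e_j` and fixes `e_i`
  obtain ⟨g, hg, H⟩ := (hfirst (i := (0, 1)) rfl hj).2 1
  have h0 := (hfirst (i := (0, 0)) rfl hi).symm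
  have hact_i : spAct g (stdVec R i) = stdVec R i := by
    rw [H, sympForm_stdVec_stdVec (fun h => hij (by rw [h, SpIdx.swap_swap])),
      sympForm_stdVec_stdVec (fun h => hi (by rw [h]; rfl))]
    simp
  have hact_zero : spAct g (stdVec R (0, 0)) = stdVec R (0, 0) - stdVec R j := by
    rw [H, (hfirst (i := (0, 0)) rfl hj).symm.1, sympForm_stdVec_left]
    simp [stdVec, SpIdx.swap, sub_eq_add_neg]
  have h1 := h0.map hg
  rw [hact_i, hact_zero] at h1
  simpa using h0.add_right h2 h1.neg_right

end SymmetricTransvections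

theorem corollary4p6 (R : Type*) [CommRing R] (h2 : IsUnit (2 : R)) (n : ℕ) (hn : 2 ≤ n) :
    spH n R = ESp n R ∧ (spH n R).Normal := by
  have hE := containsElementary_ESp (R := R) h2 hn
  have h : spH n R = ESp n R :=
    le_antisymm (spH_le h2 hE) (ESp_le h2 (containsElementary_spH h2 hn))
  exact ⟨h, h ▸ ESp_normal h2 hn hE⟩
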